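/- Let $n\ge 1$ and let $X_1,\dots,X_n$ be i.i.d. $N(0,1)$ random variables, the qualities of $n$ candidates who are interviewed one by one. The recruiter only observes whether the current candidate is the best one so far. For $c\in\{1,\dots,n\}$, the strategy with threshold $c$ rejects the first $c-1$ candidates and from then on hires the first candidate $k\ge c$ who is the best so far (that is, $X_k>X_j$ for all $j<k$); if no such candidate appears, the last one is hired. Let $V_n(c)$ be the expected quality of the candidate hired by this strategy, and let the optimal threshold index $c_*(n)$ be the smallest $c\in\{1,\dots,n\}$ that maximizes $V_n$ over $\{1,\dots,n\}$. Then there is an absolute constant $N$ such that for all $n\ge N$ $$c_*(n)\;\le\;\frac{(n-2)\,\log\log n}{\log\!\left(\frac{(n-1)^2}{2\pi}\right)}+1 .$$ -/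

import Mathlib

open MeasureTheory ProbabilityTheory

namespace Secretary

/-- Candidate `k` (candidates are numbered `0, …, n - 1` in order of arrival) is the best one
interviewed so far. Ties are not broken here: they have probability zero for i.i.d. qualities
with an atomless law. -/
def BestSoFar {n : ℕ} (x : Fin n → ℝ) (k : Fin n) : Prop :=
  ∀ j, j < k → x j < x k

/-- Candidate `k`, if interviewed, is accepted by the strategy with threshold `c`: the first
`c - 1` candidates are rejected blindly, and from then on a candidate is accepted when he or she
is the best so far; the last candidate has to be accepted in any case. -/
def Accepts {n : ℕ} (c : ℕ) (x : Fin n → ℝ) (k : Fin n) : Prop :=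
  c ≤ (k : ℕ) + 1 ∧ (BestSoFar x k ∨ (k : ℕ) + 1 = n)

/-- Candidate `k` is hired by the strategy with threshold `c`: it is the first accepted one. -/
def Hired {n : ℕ} (c : ℕ) (x : Fin n → ℝ) (k : Fin n) : Prop :=
  Accepts c x k ∧ ∀ j, j < k → ¬ Accepts c x j

/-- Exactly one candidate is hired. -/
theorem existsUnique_hired {n : ℕ} {c : ℕ} (h1 : 1 ≤ c) (hn : c ≤ n) (x : Fin n → ℝ) :
    ∃! k, Hired c x k := by
  have hlast : Accepts c x ⟨n - 1, by omega⟩ := by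
    refine ⟨?_, Or.inr ?_⟩ <;> simp only <;> omega
  obtain ⟨k, hk, hmin⟩ := wellFounded_lt.has_min {k : Fin n | Accepts c x k} ⟨_, hlast⟩
  refine ⟨k, ⟨hk, fun j hj ha => hmin j ha hj⟩, ?_⟩
  rintro l ⟨hl, hl'⟩
  rcases lt_trichotomy l k with h | h | h
  · exact absurd h (hmin l hl)
  · exact h
  · exact absurd hk (hl' k h)

open Classical in
/-- The quality of the candidate hired by the strategy with threshold `c` (for `1 ≤ c ≤ n` exactly
one term of the sum is selected). -/
noncomputable def hiredQuality {n : ℕ} (c : ℕ) (x : Fin n → ℝ) : ℝ :=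
  ∑ k, if Hired c x k then x k else 0

/-- `V_n(c)`: the expected quality of the candidate hired by the strategy with threshold `c`. -/
noncomputable def expectedQuality {Ω : Type*} [MeasurableSpace Ω] (P : Measure Ω) {n : ℕ}
    (X : Fin n → Ω → ℝ) (c : ℕ) : ℝ :=
  ∫ ω, hiredQuality c (fun k => X k ω) ∂P

/-- The optimal threshold index `c_*(n)`: the smallest `c ∈ {1, …, n}` that maximizes `V_n` over
`{1, …, n}`. -/
noncomputable def optimalThreshold {Ω : Type*} [MeasurableSpace Ω] (P : Measure Ω) {n : ℕ}
    (X : Fin n → Ω → ℝ) : ℕ :=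
  sInf {c : ℕ | c ∈ Set.Icc 1 n ∧
    ∀ d ∈ Set.Icc 1 n, expectedQuality P X d ≤ expectedQuality P X c}

/-- The set of maximizers is nonempty, so the infimum above is attained. -/
theorem optimalThreshold_mem {Ω : Type*} [MeasurableSpace Ω] (P : Measure Ω) {n : ℕ} (hn : 1 ≤ n)
    (X : Fin n → Ω → ℝ) :
    optimalThreshold P X ∈ {c : ℕ | c ∈ Set.Icc 1 n ∧
      ∀ d ∈ Set.Icc 1 n, expectedQuality P X d ≤ expectedQuality P X c} := by
  refine Nat.sInf_mem ?_
  obtain ⟨c, hc, hmax⟩ := Set.exists_max_image (Set.Icc 1 n) (expectedQuality P X)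
    (Set.finite_Icc 1 n) ⟨1, le_refl 1, hn⟩
  exact ⟨c, hc, hmax⟩

end Secretary

namespace Secretary

open Filter Topology

/-! ### The standard normal law -/

/-! Write n = N + 1 and let e_k be the mean of the maximum of candidates 0, …, k. By
exchangeability, an ordered pair of distinct candidates among 0, …, k is the best and second best
with contribution e_k / (k(k+1)) to the mean maximum. Candidate k < N is hired at threshold p + 1
exactly when it is the best of 0, …, k and the second best is among the p rejected ones; the last
candidate contributes 0. Hence V(p+1) = p ∑_{p ≤ k < N} e_k / (k(k+1)) (`integral_hiredQuality`).

By Abel summation, V(p+1) ≤ V(p) for p ≥ 2 is equivalent to ∑_{p ≤ k < N} (e_k - e_{k-1}) / k ≤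
e_{N-1} / N. An increment is the mean excess of a new candidate over the old maximum: by a
Mills-type bound it is at most 1/t times the record probability, up to an error when the old maximum
is below t (`meanMax_succ_sub_le`). With t = √(log n) / 2 the sum is at most about 1/(tp), while
e_{N-1} ≥ t/2, so p ≥ 32 n / log n suffices (`sum_increments_le_of_large`).

The stated bound is of order n log log n / log n, eventually above this level. A minimal maximizer p
+ 1 beyond the bound is impossible, since p would maximize too. -/

theorem gaussianPDFReal_zero_one (x : ℝ) :
    gaussianPDFReal 0 1 x = (√(2 * Real.pi))⁻¹ * Real.exp (-(1 / 2) * x ^ 2) := by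
  simp only [gaussianPDFReal_def]
  congr 2
  · simp
  · simp; ring

theorem hasDerivAt_gaussianPDFReal (x : ℝ) :
    HasDerivAt (gaussianPDFReal 0 1) (-(x * gaussianPDFReal 0 1 x)) x := by
  have h : HasDerivAt (fun y : ℝ => (√(2 * Real.pi))⁻¹ * Real.exp (-(1 / 2) * y ^ 2))
      ((√(2 * Real.pi))⁻¹ * (Real.exp (-(1 / 2) * x ^ 2) * (-(1 / 2) * (2 * x)))) x := by
    have := (((hasDerivAt_pow 2 x).const_mul (-(1 / 2) : ℝ)).exp).const_mul (√(2 * Real.pi))⁻¹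
    simpa using this
  have he : gaussianPDFReal 0 1 = fun y : ℝ => (√(2 * Real.pi))⁻¹ * Real.exp (-(1 / 2) * y ^ 2) :=
    funext gaussianPDFReal_zero_one
  rw [he]
  convert h using 1
  ring

theorem tendsto_pow_mul_gaussianPDFReal (n : ℕ) :
    Tendsto (fun x : ℝ => x ^ n * gaussianPDFReal 0 1 x) atTop (𝓝 0) := by
  have h := (Real.tendsto_pow_mul_exp_neg_atTop_nhds_zero n).const_mul (√(2 * Real.pi))⁻¹
  rw [mul_zero] at h
  refine squeeze_zero' ?_ ?_ h
  · filter_upwards [eventually_ge_atTop 0] with x hx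
    exact mul_nonneg (pow_nonneg hx _) (gaussianPDFReal_nonneg _ _ _)
  · filter_upwards [eventually_ge_atTop 2] with x hx
    rw [gaussianPDFReal_zero_one]
    have : Real.exp (-(1 / 2) * x ^ 2) ≤ Real.exp (-x) := Real.exp_le_exp.2 (by nlinarith)
    have h0 : 0 ≤ x ^ n := by positivity
    have h1 : 0 ≤ (√(2 * Real.pi))⁻¹ := by positivity
    calc _ = (√(2 * Real.pi))⁻¹ * (x ^ n * Real.exp (-(1 / 2) * x ^ 2)) := by ring
      _ ≤ _ := by gcongr

theorem integrable_pow_mul_gaussianPDFReal (n : ℕ) :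
    Integrable (fun x : ℝ => x ^ n * gaussianPDFReal 0 1 x) := by
  have h := (integrable_rpow_mul_exp_neg_mul_sq (b := 1 / 2) (by norm_num) (s := n)
    (by have := n.cast_nonneg (α := ℝ); linarith)).const_mul (√(2 * Real.pi))⁻¹
  refine h.congr (Eventually.of_forall fun x => ?_)
  simp only [gaussianPDFReal_zero_one, Real.rpow_natCast]
  ring

theorem setIntegral_gaussianReal {s : Set ℝ} (hs : MeasurableSet s) (f : ℝ → ℝ) :
    ∫ x in s, f x ∂(gaussianReal 0 1) = ∫ x in s, gaussianPDFReal 0 1 x * f x := by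
  rw [← integral_indicator hs, integral_gaussianReal_eq_integral_smul one_ne_zero,
    ← integral_indicator hs]
  refine integral_congr_ae (Eventually.of_forall fun x => ?_)
  by_cases hx : x ∈ s <;> simp [hx]

theorem integrable_id_gaussianReal : Integrable (fun x : ℝ => x) (gaussianReal 0 1) :=
  (memLp_id_gaussianReal (μ := 0) (v := 1) 1).integrable (by simp)

theorem integrable_sq_gaussianReal : Integrable (fun x : ℝ => x ^ 2) (gaussianReal 0 1) :=
  (memLp_id_gaussianReal (μ := 0) (v := 1) 2).integrable_sq

/-- Against the density φ the integrand is the derivative of -(x - s)φ(x), because φ' = -xφ; this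
primitive vanishes at s and at infinity. -/
theorem setIntegral_Ioi_mul_sub (s : ℝ) :
    ∫ x in Set.Ioi s, (x * (x - s) - 1) ∂(gaussianReal 0 1) = 0 := by
  rw [setIntegral_gaussianReal measurableSet_Ioi]
  have h := integral_Ioi_of_hasDerivAt_of_tendsto' (a := s) (m := 0)
    (f := fun x => -((x - s) * gaussianPDFReal 0 1 x))
    (f' := fun x => gaussianPDFReal 0 1 x * (x * (x - s) - 1)) ?_ ?_ ?_
  · rw [h]; simp
  · intro x _
    have := (((hasDerivAt_id x).sub_const s).mul (hasDerivAt_gaussianPDFReal x)).neg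
    convert! this using 1
    simp only [id]; ring
  · have := ((integrable_pow_mul_gaussianPDFReal 2).sub
      ((integrable_pow_mul_gaussianPDFReal 1).const_mul s)).sub
      (integrable_pow_mul_gaussianPDFReal 0)
    refine (this.congr (Eventually.of_forall fun x => ?_)).integrableOn
    simp; ring
  · have := ((tendsto_pow_mul_gaussianPDFReal 0).const_mul s).sub
      (tendsto_pow_mul_gaussianPDFReal 1)
    refine Tendsto.congr (fun x => ?_) (by simpa only [mul_zero, sub_zero] using this)
    simp only [pow_zero, pow_one]; ring

/-- The expected excess of a standard normal variable over a level `s`. -/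
theorem integral_excess_le (s : ℝ) :
    s * ∫ x, max (x - s) 0 ∂(gaussianReal 0 1) ≤ (gaussianReal 0 1).real (Set.Ioi s) := by
  have hint : Integrable (fun x : ℝ => x - s) (gaussianReal 0 1) :=
    integrable_id_gaussianReal.sub (integrable_const s)
  have hint2 : Integrable (fun x : ℝ => x * (x - s)) (gaussianReal 0 1) :=
    (integrable_sq_gaussianReal.sub (integrable_id_gaussianReal.const_mul s)).congr
      (Eventually.of_forall fun x => by simp; ring)
  have h1 : ∫ x, max (x - s) 0 ∂(gaussianReal 0 1)
      = ∫ x in Set.Ioi s, (x - s) ∂(gaussianReal 0 1) := by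
    rw [← integral_indicator measurableSet_Ioi]
    refine integral_congr_ae (Eventually.of_forall fun x => ?_)
    by_cases hx : s < x
    · simp [hx, hx.le]
    · simp [hx, not_lt.1 hx]
  -- On x > s one has s(x - s) ≤ x(x - s) whatever the sign of s, and the right side integrates to
  -- the tail mass.
  have h2 : s * ∫ x in Set.Ioi s, (x - s) ∂(gaussianReal 0 1)
      ≤ ∫ x in Set.Ioi s, x * (x - s) ∂(gaussianReal 0 1) := by
    rw [← integral_const_mul]
    refine setIntegral_mono_on (hint.const_mul s).integrableOn hint2.integrableOn
      measurableSet_Ioi fun x hx => ?_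
    have : s < x := hx
    nlinarith
  have h3 := setIntegral_Ioi_mul_sub s
  rw [integral_sub hint2.integrableOn (integrable_const 1)] at h3
  simp only [integral_const, MeasurableSet.univ, measureReal_restrict_apply, Set.univ_inter,
    smul_eq_mul, mul_one] at h3
  rw [h1]
  linarith

/-- The density on [t, t+1] is at least q, since x² ≤ 2(t² + 1) there; then 1 - q ≤ exp(-q). The
exponential form is convenient for taking powers. -/
theorem gaussianReal_real_Iio_le (t : ℝ) :
    (gaussianReal 0 1).real (Set.Iio t)
      ≤ Real.exp (-((√(2 * Real.pi))⁻¹ * Real.exp (-(t ^ 2 + 1)))) := by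
  set q := (√(2 * Real.pi))⁻¹ * Real.exp (-(t ^ 2 + 1))
  have hq : q ≤ (gaussianReal 0 1).real (Set.Icc t (t + 1)) := by
    have h := setIntegral_gaussianReal (measurableSet_Icc (a := t) (b := t + 1)) (fun _ => 1)
    simp only [integral_const, MeasurableSet.univ, measureReal_restrict_apply, Set.univ_inter,
      smul_eq_mul, mul_one] at h
    rw [h]
    have h2 : ∫ x in Set.Icc t (t + 1), q ≤ ∫ x in Set.Icc t (t + 1), gaussianPDFReal 0 1 x := by
      refine setIntegral_mono_on (integrableOn_const (by simp))
        (integrable_gaussianPDFReal 0 1).integrableOn measurableSet_Icc fun x hx => ?_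
      rw [gaussianPDFReal_zero_one]
      refine mul_le_mul_of_nonneg_left (Real.exp_le_exp.2 ?_) (by positivity)
      nlinarith [hx.1, hx.2, sq_nonneg (t - 1)]
    simpa using h2
  have hd : (gaussianReal 0 1).real (Set.Iio t) + (gaussianReal 0 1).real (Set.Icc t (t + 1))
      ≤ 1 := by
    rw [← measureReal_union _ measurableSet_Icc]
    · exact measureReal_le_one
    · rw [Set.disjoint_left]
      exact fun x hx hx' => absurd hx'.1 (not_le.2 hx)
  have := Real.add_one_le_exp (-q)
  linarith

/-! ### Products of copies of one law -/

section Pi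

variable {ι : Type*} [Fintype ι] {E : Type*} [MeasurableSpace E] (μ : Measure E)
  [IsProbabilityMeasure μ]

theorem measurePreserving_comp_perm (σ : Equiv.Perm ι) :
    MeasurePreserving (fun x : ι → E => x ∘ σ) (Measure.pi fun _ => μ)
      (Measure.pi fun _ => μ) := by
  have hm : Measurable fun x : ι → E => x ∘ σ :=
    measurable_pi_lambda _ fun i => measurable_pi_apply (σ i)
  refine ⟨hm, (Measure.pi_eq fun s hs => ?_).symm⟩
  rw [Measure.map_apply hm (MeasurableSet.univ_pi hs)]
  have : (fun x : ι → E => x ∘ σ) ⁻¹' Set.univ.pi s = Set.univ.pi fun i => s (σ.symm i) := by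
    ext x
    simp only [Set.mem_preimage, Set.mem_univ_pi, Function.comp_apply]
    exact ⟨fun h i => by simpa using h (σ.symm i), fun h i => by simpa using h (σ i)⟩
  rw [this, Measure.pi_pi]
  exact Equiv.prod_comp σ.symm fun i => μ (s i)

variable [DecidableEq ι]

theorem measurable_update_prod {ι E : Type*} [DecidableEq ι] [MeasurableSpace E] (k : ι) :
    Measurable (fun z : (ι → E) × E => Function.update z.1 k z.2) := by
  refine measurable_pi_lambda _ fun i => ?_
  by_cases h : i = k
  · subst h; simpa using measurable_snd
  · simp only [Function.update_of_ne h]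
    exact (measurable_pi_apply i).comp measurable_fst

/-- Resampling one coordinate independently preserves the law. This gives Fubini in coordinate k
without splitting the index type. -/
theorem measurePreserving_update (k : ι) :
    MeasurePreserving (fun z : (ι → E) × E => Function.update z.1 k z.2)
      ((Measure.pi fun _ => μ).prod μ) (Measure.pi fun _ => μ) := by
  have hm := measurable_update_prod (E := E) k
  refine ⟨hm, (Measure.pi_eq fun s hs => ?_).symm⟩
  rw [Measure.map_apply hm (MeasurableSet.univ_pi hs)]
  have : (fun z : (ι → E) × E => Function.update z.1 k z.2) ⁻¹' Set.univ.pi s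
      = (Set.univ.pi (Function.update s k Set.univ)) ×ˢ s k := by
    ext ⟨x, y⟩
    simp only [Set.mem_preimage, Set.mem_univ_pi, Set.mem_prod]
    constructor
    · refine fun h => ⟨fun i => ?_, by simpa using h k⟩
      by_cases hi : i = k
      · subst hi; simp
      · simpa [hi] using h i
    · rintro ⟨h, hk⟩ i
      by_cases hi : i = k
      · subst hi; simpa using hk
      · simpa [hi] using h i
  rw [this, Measure.prod_prod, Measure.pi_pi, ← Finset.prod_erase_mul _ _ (Finset.mem_univ k),
    ← Finset.prod_erase_mul Finset.univ (fun i => μ (s i)) (Finset.mem_univ k)]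
  simp only [Function.update_self, measure_univ, mul_one]
  congr 1
  refine Finset.prod_congr rfl fun i hi => ?_
  rw [Function.update_of_ne (Finset.ne_of_mem_erase hi)]

theorem integral_pi_update (k : ι) {f : (ι → E) → ℝ} (hf : Integrable f (Measure.pi fun _ => μ)) :
    ∫ x, f x ∂(Measure.pi fun _ => μ)
      = ∫ x, ∫ y, f (Function.update x k y) ∂μ ∂(Measure.pi fun _ => μ) := by
  have hp := measurePreserving_update (ι := ι) μ k
  rw [← hp.map_eq, integral_map hp.measurable.aemeasurable (by rw [hp.map_eq]; exact hf.1),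
    hp.map_eq, integral_prod]
  exact hp.integrable_comp_of_integrable hf

theorem ae_injective_pi [MeasurableEq E] [NullSingletonClass μ] :
    ∀ᵐ x ∂(Measure.pi fun _ : ι => μ), Function.Injective x := by
  have h : ∀ i j : ι, i ≠ j → ∀ᵐ x ∂(Measure.pi fun _ : ι => μ), x i ≠ x j := by
    intro i j hij
    have hp := measurePreserving_update (ι := ι) μ i
    have hms : MeasurableSet {x : ι → E | x i ≠ x j} :=
      (measurableSet_eq_fun (measurable_pi_apply i) (measurable_pi_apply j)).compl
    rw [← hp.map_eq, ae_map_iff hp.measurable.aemeasurable hms]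
    refine (Measure.ae_prod_iff_ae_ae (hp.measurable hms)).2 (Eventually.of_forall fun x => ?_)
    have : ∀ᵐ y ∂μ, y ≠ x j := by
      rw [ae_iff]; simp
    filter_upwards [this] with y hy
    simpa [hij.symm] using hy
  have h' : ∀ᵐ x ∂(Measure.pi fun _ : ι => μ), ∀ i j : ι, i ≠ j → x i ≠ x j := by
    rw [ae_all_iff]; intro i
    rw [ae_all_iff]; intro j
    by_cases hij : i = j
    · simp [hij]
    · filter_upwards [h i j hij] with x hx _ using hx
  filter_upwards [h'] with x hx i j hij
  by_contra hne
  exact hx i j hne hij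

end Pi

/-! ### Running maxima -/

/-- The maximum of the qualities of the candidates `0, …, k`. -/
noncomputable def prefixMax {N : ℕ} (k : ℕ) (x : Fin (N + 1) → ℝ) : ℝ :=
  -- Indices beyond N wrap around modulo N + 1, so for k ≥ N this is the overall maximum.
  partialSups (fun j : ℕ => x (Fin.ofNat (N + 1) j)) k

theorem ofNat_eq_mk {N k : ℕ} (h : k < N + 1) : Fin.ofNat (N + 1) k = ⟨k, h⟩ :=
  Fin.ext (Nat.mod_eq_of_lt h)

variable {N : ℕ}

theorem prefixMax_zero (x : Fin (N + 1) → ℝ) : prefixMax 0 x = x 0 := by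
  simp [prefixMax]

theorem prefixMax_succ {k : ℕ} (h : k + 1 < N + 1) (x : Fin (N + 1) → ℝ) :
    prefixMax (k + 1) x = max (prefixMax k x) (x ⟨k + 1, h⟩) := by
  rw [prefixMax, partialSups_add_one, ofNat_eq_mk h]
  rfl

theorem le_prefixMax {k : ℕ} (x : Fin (N + 1) → ℝ) {j : Fin (N + 1)} (h : (j : ℕ) ≤ k) :
    x j ≤ prefixMax k x := by
  have := le_partialSups_of_le (fun j : ℕ => x (Fin.ofNat (N + 1) j)) h
  rwa [ofNat_eq_mk j.2] at this

theorem exists_eq_prefixMax {k : ℕ} (hk : k ≤ N) (x : Fin (N + 1) → ℝ) :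
    ∃ j : Fin (N + 1), (j : ℕ) ≤ k ∧ x j = prefixMax k x := by
  induction k with
  | zero => exact ⟨0, le_rfl, (prefixMax_zero x).symm⟩
  | succ k ih =>
    obtain ⟨j, hj, hx⟩ := ih (by omega)
    rw [prefixMax_succ (by omega)]
    rcases le_total (prefixMax k x) (x ⟨k + 1, by omega⟩) with h | h
    · exact ⟨⟨k + 1, by omega⟩, le_rfl, (max_eq_right h).symm⟩
    · exact ⟨j, by omega, by rw [hx, max_eq_left h]⟩

theorem measurable_prefixMax (k : ℕ) : Measurable (prefixMax k : (Fin (N + 1) → ℝ) → ℝ) := by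
  unfold prefixMax
  induction k with
  | zero => simpa using measurable_pi_apply _
  | succ k ih =>
    simp only [partialSups_add_one]
    exact ih.sup (measurable_pi_apply _)

theorem prefixMax_update {k : ℕ} (hk : k ≤ N) {i : Fin (N + 1)} (hi : k < i)
    (x : Fin (N + 1) → ℝ) (y : ℝ) : prefixMax k (Function.update x i y) = prefixMax k x := by
  have hne : ∀ j : Fin (N + 1), (j : ℕ) ≤ k → Function.update x i y j = x j := fun j hj =>
    Function.update_of_ne (by rintro rfl; omega) _ _
  apply le_antisymm
  · obtain ⟨j, hj, hx⟩ := exists_eq_prefixMax hk (Function.update x i y)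
    rw [← hx, hne j hj]
    exact le_prefixMax x hj
  · obtain ⟨j, hj, hx⟩ := exists_eq_prefixMax hk x
    rw [← hx, ← hne j hj]
    exact le_prefixMax _ hj

/-- The law of `N + 1` independent standard normal variables. -/
noncomputable abbrev iidNormal (N : ℕ) : Measure (Fin (N + 1) → ℝ) :=
  Measure.pi fun _ => gaussianReal 0 1

theorem integrable_comp_eval (k : Fin (N + 1)) {f : ℝ → ℝ} (hf : Integrable f (gaussianReal 0 1)) :
    Integrable (fun x => f (x k)) (iidNormal N) :=
  (measurePreserving_eval (fun _ : Fin (N + 1) => gaussianReal 0 1) k).integrable_comp_of_integrable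
    hf

theorem integrable_eval (k : Fin (N + 1)) : Integrable (fun x => x k) (iidNormal N) :=
  integrable_comp_eval k integrable_id_gaussianReal

theorem integrable_prefixMax (k : ℕ) : Integrable (prefixMax k) (iidNormal N) := by
  unfold prefixMax
  induction k with
  | zero => simpa using integrable_eval (N := N) 0
  | succ k ih =>
    simp only [partialSups_add_one]
    exact ih.sup (integrable_eval _)

theorem ae_injective_iidNormal : ∀ᵐ x ∂(iidNormal N), Function.Injective x :=
  haveI := nullSingletonClass_gaussianReal (μ := 0) (v := 1) one_ne_zero
  ae_injective_pi _

/-- The expected maximum of the first `k + 1` qualities. -/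
noncomputable def meanMax (N k : ℕ) : ℝ := ∫ x, prefixMax k x ∂(iidNormal N)

/-! ### The best two candidates -/

/-- Among the candidates `0, …, k` candidate `a` is the best and `b` is the second best. -/
def topTwo (k : ℕ) (a b : Fin (N + 1)) : Set (Fin (N + 1) → ℝ) :=
  {x | x b < x a ∧ ∀ j : Fin (N + 1), (j : ℕ) ≤ k → j ≠ a → j ≠ b → x j < x b}

theorem measurableSet_topTwo (k : ℕ) (a b : Fin (N + 1)) : MeasurableSet (topTwo k a b) := by
  refine (measurableSet_lt (measurable_pi_apply b) (measurable_pi_apply a)).inter ?_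
  refine measurableSet_setOfPred.2 (Measurable.forall fun j => ?_)
  refine measurable_const.imp (measurable_const.imp (measurable_const.imp ?_))
  exact measurableSet_setOfPred.1 (measurableSet_lt (measurable_pi_apply j) (measurable_pi_apply b))

theorem topTwo_unique {k : ℕ} {a b a' b' : Fin (N + 1)} {x : Fin (N + 1) → ℝ}
    (ha : (a : ℕ) ≤ k) (hb : (b : ℕ) ≤ k) (ha' : (a' : ℕ) ≤ k) (hb' : (b' : ℕ) ≤ k)
    (h : x ∈ topTwo k a b) (h' : x ∈ topTwo k a' b') : a = a' ∧ b = b' := by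
  have key : ∀ {a b a' : Fin (N + 1)}, (a' : ℕ) ≤ k → x ∈ topTwo k a b → a ≠ a' → x a' < x a := by
    intro a b a' ha' h hne
    by_cases hb : a' = b
    · rw [hb]; exact h.1
    · exact (h.2 a' ha' hne.symm hb).trans h.1
  have haa : a = a' := by
    by_contra hne
    exact lt_asymm (key ha' h hne) (key ha h' (Ne.symm hne))
  subst haa
  refine ⟨rfl, ?_⟩
  by_contra hne
  have hba : b ≠ a := by rintro rfl; exact lt_irrefl _ h.1
  have hba' : b' ≠ a := by rintro rfl; exact lt_irrefl _ h'.1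
  exact lt_asymm (h.2 b' hb' hba' (Ne.symm hne)) (h'.2 b hb hba hne)

theorem exists_topTwo {k : ℕ} (hk : 1 ≤ k) (hkN : k ≤ N) {x : Fin (N + 1) → ℝ}
    (hx : Function.Injective x) :
    ∃ a b : Fin (N + 1), (a : ℕ) ≤ k ∧ (b : ℕ) ≤ k ∧ a ≠ b ∧ x ∈ topTwo k a b := by
  classical
  let S : Finset (Fin (N + 1)) := {j | (j : ℕ) ≤ k}
  obtain ⟨a, ha, hmax⟩ := S.exists_max_image x ⟨0, by simp [S]⟩
  have hS : (S.erase a).Nonempty := by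
    by_cases h0 : a = 0
    · refine ⟨⟨1, by omega⟩, Finset.mem_erase.2 ⟨?_, by simp [S, hk]⟩⟩
      rw [h0]; intro h; simpa using congrArg Fin.val h
    · exact ⟨0, Finset.mem_erase.2 ⟨Ne.symm h0, by simp [S]⟩⟩
  obtain ⟨b, hb, hmax'⟩ := (S.erase a).exists_max_image x hS
  rw [Finset.mem_erase] at hb
  have lt_of : ∀ {i j : Fin (N + 1)}, i ≠ j → x i ≤ x j → x i < x j := fun hij h =>
    lt_of_le_of_ne h fun he => hij (hx he)
  refine ⟨a, b, by simpa [S] using ha, by simpa [S] using hb.2, Ne.symm hb.1,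
    lt_of hb.1 (hmax b hb.2), fun j hj hja hjb => lt_of hjb (hmax' j ?_)⟩
  exact Finset.mem_erase.2 ⟨hja, by simpa [S] using hj⟩

theorem eq_prefixMax_of_mem_topTwo {k : ℕ} (hkN : k ≤ N) {a b : Fin (N + 1)} (ha : (a : ℕ) ≤ k)
    {x : Fin (N + 1) → ℝ} (h : x ∈ topTwo k a b) : x a = prefixMax k x := by
  refine le_antisymm (le_prefixMax x ha) ?_
  obtain ⟨j, hj, hx⟩ := exists_eq_prefixMax hkN x
  rw [← hx]
  by_cases hja : j = a
  · rw [hja]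
  by_cases hjb : j = b
  · rw [hjb]; exact h.1.le
  · exact ((h.2 j hj hja hjb).trans h.1).le

/-- The expected quality of `a` on the event that `a` is best and `b` second best. -/
noncomputable def topTwoMean (k : ℕ) (a b : Fin (N + 1)) : ℝ :=
  ∫ x, (topTwo k a b).indicator (fun x => x a) x ∂(iidNormal N)

theorem integrable_topTwo_indicator (k : ℕ) (a b : Fin (N + 1)) :
    Integrable ((topTwo k a b).indicator fun x => x a) (iidNormal N) :=
  (integrable_eval a).indicator (measurableSet_topTwo k a b)

theorem topTwoMean_swap {k : ℕ} {i j : Fin (N + 1)} (hi : (i : ℕ) ≤ k) (hj : (j : ℕ) ≤ k)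
    (a b : Fin (N + 1)) :
    topTwoMean k a b = topTwoMean k (Equiv.swap i j a) (Equiv.swap i j b) := by
  have hp : MeasurePreserving _ (iidNormal N) (iidNormal N) :=
    measurePreserving_comp_perm (gaussianReal 0 1) (Equiv.swap i j)
  have hle : ∀ l : Fin (N + 1), (l : ℕ) ≤ k → (Equiv.swap i j l : ℕ) ≤ k := by
    intro l hl
    rw [Equiv.swap_apply_def]
    split_ifs <;> assumption
  unfold topTwoMean
  have hmap := integral_map (f := (topTwo k a b).indicator fun x => x a) hp.aemeasurable
    (by rw [hp.map_eq]; exact (integrable_topTwo_indicator k a b).1)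
  rw [hp.map_eq] at hmap
  rw [hmap]
  · refine integral_congr_ae (Eventually.of_forall fun x => ?_)
    have : x ∘ Equiv.swap i j ∈ topTwo k a b
        ↔ x ∈ topTwo k (Equiv.swap i j a) (Equiv.swap i j b) := by
      refine and_congr Iff.rfl ⟨fun h l hl hla hlb => ?_, fun h l hl hla hlb => ?_⟩
      · have := h (Equiv.swap i j l) (hle l hl) (fun h => hla (by rw [← h]; simp))
          (fun h => hlb (by rw [← h]; simp))
        simpa using this
      · exact h _ (hle l hl) (by simpa using hla) (by simpa using hlb)
    by_cases hx : x ∘ Equiv.swap i j ∈ topTwo k a b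
    · simp only [Set.indicator_of_mem hx, Set.indicator_of_mem (this.1 hx), Function.comp_apply]
    · simp only [Set.indicator_of_notMem hx, Set.indicator_of_notMem (fun h => hx (this.2 h))]

/-- Two swaps inside the prefix suffice: one sends a to a', the next sends the image of b to b' and
fixes a'. -/
theorem topTwoMean_eq {k : ℕ} {a b a' b' : Fin (N + 1)}
    (ha : (a : ℕ) ≤ k) (hb : (b : ℕ) ≤ k) (ha' : (a' : ℕ) ≤ k) (hb' : (b' : ℕ) ≤ k)
    (hab : a ≠ b) (hab' : a' ≠ b') : topTwoMean k a b = topTwoMean k a' b' := by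
  have hle : (Equiv.swap a a' b : ℕ) ≤ k := by
    rw [Equiv.swap_apply_def]
    split_ifs <;> assumption
  have hne : a' ≠ Equiv.swap a a' b := by
    intro h
    apply hab
    have := congrArg (Equiv.swap a a') h
    simpa using this
  rw [topTwoMean_swap ha ha' a b, topTwoMean_swap hle hb', Equiv.swap_apply_left,
    Equiv.swap_apply_left, Equiv.swap_apply_of_ne_of_ne hne hab']

/-- Almost surely exactly one of the k(k+1) ordered pairs is the top two, and its first member
attains the prefix maximum; by symmetry all pairs share the mean equally. -/
theorem topTwoMean_eq_meanMax {k : ℕ} (hk : 1 ≤ k) (hkN : k ≤ N) {a b : Fin (N + 1)}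
    (ha : (a : ℕ) ≤ k) (hb : (b : ℕ) ≤ k) (hab : a ≠ b) :
    topTwoMean k a b = meanMax N k / (k * (k + 1)) := by
  classical
  let S : Finset (Fin (N + 1)) := {j | (j : ℕ) ≤ k}
  have hS : S.card = k + 1 := by
    have : S = Finset.Iic (⟨k, by omega⟩ : Fin (N + 1)) := by
      ext j; simp [S, Fin.le_def]
    rw [this]; simp
  have hsum : meanMax N k = ∑ p ∈ S.offDiag, topTwoMean k p.1 p.2 := by
    unfold topTwoMean meanMax
    rw [← integral_finsetSum _ fun p _ => integrable_topTwo_indicator k p.1 p.2]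
    refine integral_congr_ae ?_
    filter_upwards [ae_injective_iidNormal] with x hx
    obtain ⟨a, b, ha, hb, hab, hmem⟩ := exists_topTwo hk hkN hx
    rw [Finset.sum_eq_single (a, b), Set.indicator_of_mem hmem,
      eq_prefixMax_of_mem_topTwo hkN ha hmem]
    · rintro ⟨a', b'⟩ hp hne
      simp only [Finset.mem_offDiag, S, Finset.mem_filter, Finset.mem_univ, true_and] at hp
      refine Set.indicator_of_notMem (fun h => hne ?_) _
      obtain ⟨h1, h2⟩ := topTwo_unique ha hb hp.1 hp.2.1 hmem h
      rw [h1, h2]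
    · intro h
      exact absurd (by simp [S, ha, hb, hab]) h
  rw [Finset.sum_congr rfl (g := fun _ => topTwoMean k a b) (fun p hp => ?_), Finset.sum_const,
    Finset.offDiag_card, hS] at hsum
  · rw [hsum, nsmul_eq_mul]
    have h1 : (k + 1) * (k + 1) - (k + 1) = k * (k + 1) := by
      rw [Nat.sub_eq_iff_eq_add (by nlinarith)]; ring
    have h2 : (k : ℝ) ≠ 0 := by positivity
    rw [h1]; push_cast; field_simp
  · simp only [Finset.mem_offDiag, S, Finset.mem_filter, Finset.mem_univ, true_and] at hp
    exact topTwoMean_eq hp.1 hp.2.1 ha hb hp.2.2 hab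

/-! ### The value of a threshold strategy -/

theorem measurable_accepts (c : ℕ) (k : Fin (N + 1)) :
    Measurable fun x : Fin (N + 1) → ℝ => Accepts c x k := by
  refine measurable_const.and (Measurable.or ?_ measurable_const)
  refine Measurable.forall fun j => measurable_const.imp ?_
  exact measurableSet_setOfPred.1 (measurableSet_lt (measurable_pi_apply j) (measurable_pi_apply k))

theorem measurableSet_hired (c : ℕ) (k : Fin (N + 1)) :
    MeasurableSet {x : Fin (N + 1) → ℝ | Hired c x k} := by
  refine measurableSet_setOfPred.2 ((measurable_accepts c k).and ?_)
  exact Measurable.forall fun j => measurable_const.imp (measurable_accepts c j).not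

/-- The runner-up b is the best of the candidates before k. If b came after the rejected block it
would itself have been accepted; if it lies in the block, nobody between can be a record. The last
candidate is excluded because it is accepted unconditionally. -/
theorem hired_iff {p : ℕ} (hp : 1 ≤ p) {k : Fin (N + 1)} (hpk : p ≤ k) (hkN : (k : ℕ) < N)
    {x : Fin (N + 1) → ℝ} (hx : Function.Injective x) :
    Hired (p + 1) x k ↔ ∃ b : Fin (N + 1), (b : ℕ) < p ∧ x ∈ topTwo k k b := by
  constructor
  · rintro ⟨⟨-, hbest⟩, hnone⟩
    replace hbest : BestSoFar x k := hbest.resolve_right (by omega)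
    obtain ⟨a, b, ha, hb, hab, hmem⟩ := exists_topTwo (by omega) hkN.le hx
    have hak : a = k := by
      by_contra hne
      have h1 := hbest a (lt_of_le_of_ne ha hne)
      have h2 := le_prefixMax x (le_refl (k : ℕ))
      rw [← eq_prefixMax_of_mem_topTwo hkN.le ha hmem] at h2
      exact absurd h1 (not_lt.2 h2)
    subst hak
    refine ⟨b, ?_, hmem⟩
    by_contra hpb
    have hba : b < a := lt_of_le_of_ne hb (Ne.symm hab)
    refine hnone b hba ⟨by omega, Or.inl fun j hj => hmem.2 j ?_ ?_ hj.ne⟩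
    · exact (hj.trans hba).le
    · exact (hj.trans hba).ne
  · rintro ⟨b, hbp, hmem⟩
    have hlt : ∀ j, j < k → x j < x k := by
      intro j hj
      by_cases hjb : j = b
      · rw [hjb]; exact hmem.1
      · exact (hmem.2 j hj.le hj.ne hjb).trans hmem.1
    refine ⟨⟨by omega, Or.inl hlt⟩, ?_⟩
    rintro j hj ⟨hpj, hbest⟩
    have hj' : (j : ℕ) < k := hj
    replace hbest : BestSoFar x j := hbest.resolve_right (by omega)
    have hbj : b < j := by rw [Fin.lt_def]; omega
    exact lt_asymm (hbest b hbj) (hmem.2 j hj.le hj.ne hbj.ne')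

open Classical in
theorem integral_hired {p : ℕ} (hp : 1 ≤ p) {k : Fin (N + 1)} (hpk : p ≤ k) (hkN : (k : ℕ) < N) :
    ∫ x, (if Hired (p + 1) x k then x k else 0) ∂(iidNormal N)
      = p * (meanMax N k / (k * (k + 1))) := by
  let S : Finset (Fin (N + 1)) := {j | (j : ℕ) < p}
  have hS : S.card = p := by
    have : S = Finset.Iio (⟨p, by omega⟩ : Fin (N + 1)) := by
      ext j; simp [S, Fin.lt_def]
    rw [this]; simp
  have hmem : ∀ b, b ∈ S ↔ (b : ℕ) < p := fun b => by simp [S]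
  have h1 : ∫ x, (if Hired (p + 1) x k then x k else 0) ∂(iidNormal N)
      = ∑ b ∈ S, topTwoMean k k b := by
    unfold topTwoMean
    rw [← integral_finsetSum _ fun b _ => integrable_topTwo_indicator k k b]
    refine integral_congr_ae ?_
    filter_upwards [ae_injective_iidNormal] with x hx
    by_cases h : Hired (p + 1) x k
    · rw [if_pos h]
      obtain ⟨b, hb, hxb⟩ := (hired_iff hp hpk hkN hx).1 h
      rw [Finset.sum_eq_single b, Set.indicator_of_mem hxb]
      · intro b' hb' hne
        rw [hmem] at hb'
        refine Set.indicator_of_notMem (fun h' => hne ?_) _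
        exact (topTwo_unique le_rfl (by omega) le_rfl (by omega) h' hxb).2
      · exact fun h => absurd ((hmem b).2 hb) h
    · rw [if_neg h]
      refine (Finset.sum_eq_zero fun b hb => Set.indicator_of_notMem (fun h' => h ?_) _).symm
      exact (hired_iff hp hpk hkN hx).2 ⟨b, (hmem b).1 hb, h'⟩
  rw [h1, Finset.sum_congr rfl (g := fun _ => meanMax N k / (k * (k + 1))) (fun b hb => ?_),
    Finset.sum_const, hS, nsmul_eq_mul]
  rw [hmem] at hb
  exact topTwoMean_eq_meanMax (by omega) hkN.le le_rfl (by omega) (by rintro rfl; omega)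

open Classical in
theorem integrable_hired (c : ℕ) (k : Fin (N + 1)) :
    Integrable (fun x => if Hired c x k then x k else 0) (iidNormal N) := by
  refine ((integrable_eval k).indicator (measurableSet_hired c k)).congr
    (Eventually.of_forall fun x => ?_)
  simp [Set.indicator_apply]

open Classical in
-- Whether the last candidate is reached depends only on the earlier qualities, and its own quality
-- has mean 0.
theorem integral_hired_last {c : ℕ} (hc : c ≤ N + 1) :
    ∫ x, (if Hired c x (Fin.last N) then x (Fin.last N) else 0) ∂(iidNormal N) = 0 := by
  have hlast : ∀ x : Fin (N + 1) → ℝ, Hired c x (Fin.last N)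
      ↔ ∀ j < Fin.last N, ¬ Accepts c x j := fun x =>
    and_iff_right ⟨by simpa using hc, Or.inr (by simp)⟩
  have hupd : ∀ (x : Fin (N + 1) → ℝ) (y : ℝ),
      Hired c (Function.update x (Fin.last N) y) (Fin.last N) ↔ Hired c x (Fin.last N) := by
    intro x y
    rw [hlast, hlast]
    refine forall₂_congr fun j hj => not_congr (and_congr Iff.rfl (or_congr ?_ Iff.rfl))
    refine forall₂_congr fun i hi => ?_
    rw [Function.update_of_ne hj.ne, Function.update_of_ne (hi.trans hj).ne]
  rw [integral_pi_update _ (Fin.last N) (integrable_hired c _)]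
  simp only [hupd, Function.update_self]
  refine integral_eq_zero_of_ae (Eventually.of_forall fun x => ?_)
  by_cases h : Hired c x (Fin.last N) <;> simp [h]

theorem integral_hiredQuality {p : ℕ} (hp : 1 ≤ p) (hpN : p ≤ N) :
    ∫ x, hiredQuality (p + 1) x ∂(iidNormal N)
      = p * ∑ k ∈ Finset.Ico p N, meanMax N k / (k * (k + 1)) := by
  classical
  have h : ∀ x : Fin (N + 1) → ℝ, hiredQuality (p + 1) x
      = ∑ k, if Hired (p + 1) x k then x k else 0 := fun x => by
    unfold hiredQuality
    exact Finset.sum_congr rfl fun k _ => by congr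
  simp only [h]
  rw [integral_finsetSum _ fun k _ => integrable_hired (p + 1) k, Fin.sum_univ_castSucc,
    integral_hired_last (by omega), add_zero, Finset.mul_sum]
  have h2 : ∀ k : Fin N, ∫ x, (if Hired (p + 1) x k.castSucc then x k.castSucc else 0)
      ∂(iidNormal N) = if p ≤ (k : ℕ) then (p : ℝ) * (meanMax N k / (k * (k + 1))) else 0 := by
    intro k
    split_ifs with hk
    · exact integral_hired hp (k := k.castSucc) hk k.2
    · refine integral_eq_zero_of_ae (Eventually.of_forall fun x => if_neg fun hh => hk ?_)
      have := hh.1.1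
      simpa using this
  rw [Finset.sum_congr rfl fun k _ => h2 k, Finset.sum_fin_eq_sum_range, Finset.range_eq_Ico,
    ← Finset.sum_subset (Finset.Ico_subset_Ico_left (Nat.zero_le p))]
  · refine Finset.sum_congr rfl fun k hk => ?_
    rw [Finset.mem_Ico] at hk
    simp [hk.1, hk.2]
  · intro k hk hk'
    simp only [Finset.mem_Ico, not_and, not_lt, zero_le, true_and] at hk hk'
    rw [dif_pos hk, if_neg fun h => by have := hk' h; omega]

/-- Abel summation for the sum in the value of a threshold strategy. -/
theorem sum_Ico_div_mul_succ (e : ℕ → ℝ) {p N : ℕ} (hp : 1 ≤ p) (hpN : p ≤ N) :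
    ∑ k ∈ Finset.Ico p N, e k / (k * (k + 1))
      = e (p - 1) / p - e (N - 1) / N + ∑ k ∈ Finset.Ico p N, (e k - e (k - 1)) / k := by
  induction N, hpN using Nat.le_induction with
  | base => simp
  | succ N hN ih =>
    have h1 : (N : ℝ) ≠ 0 := by rw [Nat.cast_ne_zero]; omega
    rw [Finset.sum_Ico_succ_top hN, Finset.sum_Ico_succ_top hN, ih]
    push_cast
    field_simp
    ring

theorem integrable_pi_update {ι E : Type*} [Fintype ι] [DecidableEq ι] [MeasurableSpace E]
    (μ : Measure E) [IsProbabilityMeasure μ] (k : ι) {f : (ι → E) → ℝ}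
    (hf : Integrable f (Measure.pi fun _ => μ)) :
    Integrable (fun x => ∫ y, f (Function.update x k y) ∂μ) (Measure.pi fun _ => μ) :=
  ((measurePreserving_update μ k).integrable_comp_of_integrable hf).integral_prod_left

/-! ### The probability of a record -/

/-- Candidate `a` is the best among the candidates `0, …, k`. -/
def isTop (k : ℕ) (a : Fin (N + 1)) : Set (Fin (N + 1) → ℝ) :=
  {x | ∀ j : Fin (N + 1), (j : ℕ) ≤ k → j ≠ a → x j < x a}

theorem measurableSet_isTop (k : ℕ) (a : Fin (N + 1)) : MeasurableSet (isTop k a) := by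
  refine measurableSet_setOfPred.2 (Measurable.forall fun j => ?_)
  refine measurable_const.imp (measurable_const.imp ?_)
  exact measurableSet_setOfPred.1 (measurableSet_lt (measurable_pi_apply j) (measurable_pi_apply a))

theorem measureReal_isTop_eq {k : ℕ} {i j : Fin (N + 1)} (hi : (i : ℕ) ≤ k) (hj : (j : ℕ) ≤ k) :
    (iidNormal N).real (isTop k i) = (iidNormal N).real (isTop k j) := by
  have hp : MeasurePreserving _ (iidNormal N) (iidNormal N) :=
    measurePreserving_comp_perm (gaussianReal 0 1) (Equiv.swap i j)
  have hle : ∀ l : Fin (N + 1), (l : ℕ) ≤ k → (Equiv.swap i j l : ℕ) ≤ k := by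
    intro l hl
    rw [Equiv.swap_apply_def]
    split_ifs <;> assumption
  rw [← hp.measureReal_preimage (measurableSet_isTop k i).nullMeasurableSet]
  congr 1
  ext x
  constructor
  · intro h l hl hlj
    have := h (Equiv.swap i j l) (hle l hl) (fun h => hlj (by
      have := congrArg (Equiv.swap i j) h
      simpa using this))
    simpa using this
  · intro h l hl hli
    have := h (Equiv.swap i j l) (hle l hl) (fun h => hli (by
      have := congrArg (Equiv.swap i j) h
      simpa using this))
    simpa using this

/-- These are k + 1 disjoint events of equal probability. Only the upper bound is needed, so ties
play no role. -/
theorem measureReal_isTop_le {k : ℕ} (hkN : k ≤ N) {i : Fin (N + 1)} (hi : (i : ℕ) ≤ k) :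
    (iidNormal N).real (isTop k i) ≤ 1 / (k + 1) := by
  let S : Finset (Fin (N + 1)) := Finset.Iic ⟨k, by omega⟩
  have hmem : ∀ j, j ∈ S ↔ (j : ℕ) ≤ k := fun j => by simp [S, Fin.le_def]
  have hS : S.card = k + 1 := by simp [S]
  have hdisj : Set.PairwiseDisjoint (S : Set (Fin (N + 1))) (isTop k) := by
    intro a ha b hb hab
    rw [Finset.mem_coe, hmem] at ha hb
    exact Set.disjoint_left.2 fun x hxa hxb =>
      lt_asymm (hxa b hb (Ne.symm hab)) (hxb a ha hab)
  have h := measureReal_biUnion_finset (μ := iidNormal N) hdisj fun a _ => measurableSet_isTop k a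
  rw [Finset.sum_congr rfl (g := fun _ => (iidNormal N).real (isTop k i))
    (fun j hj => measureReal_isTop_eq ((hmem j).1 hj) hi), Finset.sum_const, hS,
    nsmul_eq_mul] at h
  have h1 : (iidNormal N).real (⋃ a ∈ S, isTop k a) ≤ 1 := measureReal_le_one
  rw [le_div_iff₀ (by positivity), mul_comm]
  push_cast at h
  linarith

/-! ### Products over coordinates -/

/-- The product of the indicators of `x i < t`, `i ∈ S`, times `|x a|` for `a ∈ T`. -/
noncomputable def weight (t : ℝ) (S T : Finset (Fin (N + 1))) (x : Fin (N + 1) → ℝ) : ℝ :=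
  ∏ i, (if i ∈ T then fun y : ℝ => |y| else if i ∈ S then (Set.Iio t).indicator 1 else 1) (x i)

theorem weight_nonneg (t : ℝ) (S T : Finset (Fin (N + 1))) (x : Fin (N + 1) → ℝ) :
    0 ≤ weight t S T x := by
  refine Finset.prod_nonneg fun i _ => ?_
  split_ifs
  · exact abs_nonneg _
  · exact Set.indicator_nonneg (fun _ _ => zero_le_one) _
  · exact zero_le_one

theorem weight_of_lt {t : ℝ} {S T : Finset (Fin (N + 1))} {x : Fin (N + 1) → ℝ}
    (h : ∀ i ∈ S, x i < t) : weight t S T x = ∏ i ∈ T, |x i| := by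
  classical
  unfold weight
  rw [← Finset.prod_subset (Finset.subset_univ T)]
  · exact Finset.prod_congr rfl fun i hi => by rw [if_pos hi]
  · intro i _ hi
    rw [if_neg hi]
    split_ifs with hS
    · exact Set.indicator_of_mem (f := (1 : ℝ → ℝ)) (h i hS)
    · rfl

theorem weight_empty_of_not_lt {t : ℝ} {S : Finset (Fin (N + 1))} {x : Fin (N + 1) → ℝ}
    {i : Fin (N + 1)} (hi : i ∈ S) (h : t ≤ x i) : weight t S ∅ x = 0 := by
  refine Finset.prod_eq_zero (Finset.mem_univ i) ?_
  rw [if_neg (Finset.notMem_empty i), if_pos hi]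
  exact Set.indicator_of_notMem (f := (1 : ℝ → ℝ)) (not_lt.2 h)

theorem integrable_weight (t : ℝ) (S T : Finset (Fin (N + 1))) :
    Integrable (weight t S T) (iidNormal N) := by
  refine Integrable.fintype_prod (μ := fun _ => gaussianReal 0 1) fun i => ?_
  split_ifs
  · exact integrable_id_gaussianReal.abs
  · exact (integrable_const (1 : ℝ)).indicator measurableSet_Iio
  · exact integrable_const (1 : ℝ)

theorem integral_weight (t : ℝ) {S T : Finset (Fin (N + 1))} (h : Disjoint S T) :
    ∫ x, weight t S T x ∂(iidNormal N) = (∫ y, |y| ∂(gaussianReal 0 1)) ^ T.card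
      * (gaussianReal 0 1).real (Set.Iio t) ^ S.card := by
  classical
  unfold weight
  rw [integral_fintype_prod_eq_prod (μ := fun _ => gaussianReal 0 1)
    (fun i => if i ∈ T then fun y : ℝ => |y| else if i ∈ S then (Set.Iio t).indicator 1 else 1)]
  have h1 : ∀ i, ∫ y, (if i ∈ T then fun y : ℝ => |y| else
      if i ∈ S then (Set.Iio t).indicator 1 else 1) y ∂(gaussianReal 0 1)
      = (if i ∈ T then ∫ y, |y| ∂(gaussianReal 0 1) else 1)
        * (if i ∈ S then (gaussianReal 0 1).real (Set.Iio t) else 1) := by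
    intro i
    by_cases hT : i ∈ T
    · simp [hT, Finset.disjoint_right.1 h hT]
    · by_cases hS : i ∈ S
      · simp only [hT, hS, if_true, if_false, one_mul]
        exact integral_indicator_one measurableSet_Iio
      · simp [hT, hS]
  rw [Finset.prod_congr rfl fun i _ => h1 i, Finset.prod_mul_distrib, Finset.prod_ite_mem,
    Finset.prod_ite_mem]
  simp

/-! ### Bounds for the expected maximum -/

/-- The first absolute moment of the standard normal law. -/
noncomputable def absMean : ℝ := ∫ y, |y| ∂(gaussianReal 0 1)

theorem absMean_nonneg : 0 ≤ absMean := integral_nonneg fun _ => abs_nonneg _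

/-- Pointwise, the maximum is at least t - t·1{all x_i < t} - |x_0|; the indicator has mean
Φ(t)^(k+1) by independence. -/
theorem le_meanMax {k : ℕ} (hkN : k ≤ N) (t : ℝ) :
    t * (1 - (gaussianReal 0 1).real (Set.Iio t) ^ (k + 1)) - absMean ≤ meanMax N k := by
  let S : Finset (Fin (N + 1)) := Finset.Iic ⟨k, by omega⟩
  have hmem : ∀ j, j ∈ S ↔ (j : ℕ) ≤ k := fun j => by simp [S, Fin.le_def]
  have hS : S.card = k + 1 := by simp [S]
  have hw := integral_weight t (Finset.disjoint_empty_right S)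
  rw [hS, Finset.card_empty, pow_zero, one_mul] at hw
  have ha : Integrable (fun x => |x 0|) (iidNormal N) := (integrable_eval 0).abs
  have ha' : ∫ x, |x 0| ∂(iidNormal N) = absMean := by
    have hp := measurePreserving_eval (fun _ : Fin (N + 1) => gaussianReal 0 1) 0
    have := integral_map (f := fun y : ℝ => |y|) hp.aemeasurable (by fun_prop)
    rw [hp.map_eq] at this
    exact this.symm
  have hint : Integrable (fun x => t - t * weight t S ∅ x) (iidNormal N) :=
    (integrable_const t).sub ((integrable_weight t S ∅).const_mul t)
  have h : ∫ x, (t - t * weight t S ∅ x - |x 0|) ∂(iidNormal N) ≤ meanMax N k := by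
    refine integral_mono (hint.sub ha) (integrable_prefixMax k) fun x => ?_
    have h0 : x 0 ≤ prefixMax k x := le_prefixMax x (by simp)
    by_cases hx : ∀ i ∈ S, x i < t
    · simp only [weight_of_lt hx, Finset.prod_empty]
      linarith [neg_abs_le (x 0)]
    · push Not at hx
      obtain ⟨i, hi, hti⟩ := hx
      have h1 : x i ≤ prefixMax k x := le_prefixMax x ((hmem i).1 hi)
      simp only [weight_empty_of_not_lt hi hti]
      linarith [abs_nonneg (x 0)]
  rw [integral_sub hint ha, integral_sub (integrable_const t)
    ((integrable_weight t S ∅).const_mul t), integral_const_mul, hw, ha'] at h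
  simp only [integral_const, probReal_univ, one_smul] at h
  linarith

/-- Given the old maximum s ≥ t, the newcomer's mean excess is at most P(X > s)/s ≤ P(X > s)/t.
Averaging P(X > s) over s yields the record probability, at most 1/(k+2). -/
theorem integral_excess_high_le {k : ℕ} (hkN : k + 1 ≤ N) {t : ℝ} (ht : 0 < t) :
    ∫ x, {x : Fin (N + 1) → ℝ | t ≤ prefixMax k x}.indicator
      (fun x => max (x ⟨k + 1, by omega⟩ - prefixMax k x) 0) x ∂(iidNormal N)
      ≤ 1 / t * (1 / (k + 2)) := by
  set i : Fin (N + 1) := ⟨k + 1, by omega⟩ with hi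
  have hupd : ∀ (x : Fin (N + 1) → ℝ) (y : ℝ),
      prefixMax k (Function.update x i y) = prefixMax k x := fun x y =>
    prefixMax_update (by omega) (by simp [hi]) x y
  have hint : Integrable ({x : Fin (N + 1) → ℝ | t ≤ prefixMax k x}.indicator
      (fun x => max (x i - prefixMax k x) 0)) (iidNormal N) :=
    (((integrable_eval i).sub (integrable_prefixMax k)).pos_part).indicator
      (measurableSet_le measurable_const (measurable_prefixMax k))
  have hms : MeasurableSet {x : Fin (N + 1) → ℝ | prefixMax k x < x i} :=
    measurableSet_lt (measurable_prefixMax k) (measurable_pi_apply i)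
  have hint2 : Integrable ({x : Fin (N + 1) → ℝ | prefixMax k x < x i}.indicator
      (fun _ => 1 / t)) (iidNormal N) := (integrable_const _).indicator hms
  have hrec : (iidNormal N).real {x | prefixMax k x < x i} ≤ 1 / (k + 2) := by
    have h1 : {x : Fin (N + 1) → ℝ | prefixMax k x < x i} ⊆ isTop (k + 1) i := by
      intro x hx j hj hji
      refine (le_prefixMax x ?_).trans_lt hx
      have : (j : ℕ) ≠ k + 1 := fun h => hji (Fin.ext h)
      omega
    refine (measureReal_mono h1).trans ((measureReal_isTop_le hkN (by simp [hi])).trans_eq ?_)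
    push_cast; ring
  calc _ = ∫ x, ∫ y, {x : Fin (N + 1) → ℝ | t ≤ prefixMax k x}.indicator
          (fun x => max (x i - prefixMax k x) 0) (Function.update x i y) ∂(gaussianReal 0 1)
          ∂(iidNormal N) := integral_pi_update _ i hint
    _ ≤ ∫ x, ∫ y, {x : Fin (N + 1) → ℝ | prefixMax k x < x i}.indicator
          (fun _ => 1 / t) (Function.update x i y) ∂(gaussianReal 0 1) ∂(iidNormal N) := by
        refine integral_mono (integrable_pi_update _ i hint) (integrable_pi_update _ i hint2)
          fun x => ?_
        have hr : ∫ y, {x : Fin (N + 1) → ℝ | prefixMax k x < x i}.indicator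
            (fun _ => 1 / t) (Function.update x i y) ∂(gaussianReal 0 1)
            = (gaussianReal 0 1).real (Set.Ioi (prefixMax k x)) * (1 / t) := by
          rw [← smul_eq_mul, ← integral_indicator_const _ measurableSet_Ioi]
          refine integral_congr_ae (Eventually.of_forall fun y => ?_)
          simp only [Set.indicator_apply, Set.mem_ofPred_eq, hupd, Function.update_self, Set.mem_Ioi]
        simp only [hr]
        have h0 : 0 ≤ (gaussianReal 0 1).real (Set.Ioi (prefixMax k x)) := measureReal_nonneg
        by_cases hx : t ≤ prefixMax k x
        · have hl : ∀ y, {x : Fin (N + 1) → ℝ | t ≤ prefixMax k x}.indicator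
              (fun x => max (x i - prefixMax k x) 0) (Function.update x i y)
              = max (y - prefixMax k x) 0 := fun y => by
            rw [Set.indicator_of_mem (by simpa [hupd] using hx), hupd, Function.update_self]
          simp only [hl]
          have h1 := integral_excess_le (prefixMax k x)
          have h2 : 0 ≤ ∫ y, max (y - prefixMax k x) 0 ∂(gaussianReal 0 1) :=
            integral_nonneg fun y => le_max_right _ _
          rw [mul_one_div, le_div_iff₀ ht]
          nlinarith
        · have hl : ∀ y, {x : Fin (N + 1) → ℝ | t ≤ prefixMax k x}.indicator
              (fun x => max (x i - prefixMax k x) 0) (Function.update x i y) = 0 := fun y =>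
            Set.indicator_of_notMem (by simpa [hupd] using hx) _
          simp only [hl, integral_zero]
          positivity
    _ = ∫ x, {x : Fin (N + 1) → ℝ | prefixMax k x < x i}.indicator (fun _ => 1 / t) x
          ∂(iidNormal N) := (integral_pi_update _ i hint2).symm
    _ = (iidNormal N).real {x | prefixMax k x < x i} * (1 / t) := by
        rw [integral_indicator_const _ hms, smul_eq_mul]
    _ ≤ _ := by
        rw [mul_comm]
        exact mul_le_mul_of_nonneg_left hrec (by positivity)

theorem integral_excess_low_le {k : ℕ} (hkN : k + 1 ≤ N) (t : ℝ) :
    ∫ x, {x : Fin (N + 1) → ℝ | t ≤ prefixMax k x}ᶜ.indicator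
      (fun x => max (x ⟨k + 1, by omega⟩ - prefixMax k x) 0) x ∂(iidNormal N)
      ≤ 2 * absMean * (gaussianReal 0 1).real (Set.Iio t) ^ k := by
  set i : Fin (N + 1) := ⟨k + 1, by omega⟩ with hi
  -- The excess is at most |x_i| + |x_0|. Index 0 is left out of S so that |x_0| is independent of
  -- the indicators, which costs one power of Φ.
  let S : Finset (Fin (N + 1)) := Finset.Ioc 0 ⟨k, by omega⟩
  have hS : S.card = k := by simp [S]
  have hiS : Disjoint S {i} := by simp [S, hi, Fin.le_def]
  have h0S : Disjoint S {0} := by simp [S]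
  have h1 := integral_weight t hiS
  have h2 := integral_weight t h0S
  rw [Finset.card_singleton, pow_one, hS] at h1 h2
  have hint : Integrable ({x : Fin (N + 1) → ℝ | t ≤ prefixMax k x}ᶜ.indicator
      (fun x => max (x i - prefixMax k x) 0)) (iidNormal N) :=
    (((integrable_eval i).sub (integrable_prefixMax k)).pos_part).indicator
      (measurableSet_le measurable_const (measurable_prefixMax k)).compl
  have h := integral_mono (g := fun x => weight t S {i} x + weight t S {0} x) hint
    ((integrable_weight t S {i}).add (integrable_weight t S {0})) fun x => ?_
  · rw [integral_add (integrable_weight t S {i}) (integrable_weight t S {0}), h1, h2] at h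
    refine h.trans_eq ?_
    rw [absMean]; ring
  · by_cases hx : t ≤ prefixMax k x
    · rw [Set.indicator_of_notMem (by simpa using hx)]
      exact add_nonneg (weight_nonneg _ _ _ _) (weight_nonneg _ _ _ _)
    · have hlt : ∀ j ∈ S, x j < t := fun j hj =>
        (le_prefixMax x (by simpa [S, Fin.le_def] using (Finset.mem_Ioc.1 hj).2)).trans_lt
          (not_le.1 hx)
      rw [Set.indicator_of_mem (by simpa using hx)]
      simp only [weight_of_lt hlt, Finset.prod_singleton]
      have h0 : x 0 ≤ prefixMax k x := le_prefixMax x (by simp)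
      refine max_le ?_ (by positivity)
      linarith [le_abs_self (x i), neg_abs_le (x 0)]

theorem meanMax_succ_sub_le {k : ℕ} (hkN : k + 1 ≤ N) {t : ℝ} (ht : 0 < t) :
    meanMax N (k + 1) - meanMax N k
      ≤ 1 / t * (1 / (k + 2)) + 2 * absMean * (gaussianReal 0 1).real (Set.Iio t) ^ k := by
  have hms : MeasurableSet {x : Fin (N + 1) → ℝ | t ≤ prefixMax k x} :=
    measurableSet_le measurable_const (measurable_prefixMax k)
  have hint : Integrable (fun x => max (x ⟨k + 1, by omega⟩ - prefixMax k x) 0) (iidNormal N) :=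
    ((integrable_eval _).sub (integrable_prefixMax k)).pos_part
  have h : meanMax N (k + 1) - meanMax N k
      = ∫ x, max (x ⟨k + 1, by omega⟩ - prefixMax k x) 0 ∂(iidNormal N) := by
    unfold meanMax
    rw [← integral_sub (integrable_prefixMax _) (integrable_prefixMax _)]
    refine integral_congr_ae (Eventually.of_forall fun x => ?_)
    simp only [prefixMax_succ (show k + 1 < N + 1 by omega)]
    rw [max_comm, ← max_sub_sub_right, sub_self]
  rw [h, ← integral_add_compl hms hint, ← integral_indicator hms, ← integral_indicator hms.compl]
  exact add_le_add (integral_excess_high_le hkN ht) (integral_excess_low_le hkN t)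

/-! ### The optimal threshold for large `n` -/

theorem sum_increments_le {N p : ℕ} (hp : 1 ≤ p) (hpN : p ≤ N) {t : ℝ} (ht : 0 < t) :
    ∑ k ∈ Finset.Ico p N, (meanMax N k - meanMax N (k - 1)) / k
      ≤ 1 / (t * p) + N * (2 * absMean * (gaussianReal 0 1).real (Set.Iio t) ^ (p - 1)) := by
  set Φ := (gaussianReal 0 1).real (Set.Iio t) with hΦ
  have hΦ0 : 0 ≤ Φ := measureReal_nonneg
  have hΦ1 : Φ ≤ 1 := measureReal_le_one
  have hA := absMean_nonneg
  have hterm : ∀ k ∈ Finset.Ico p N, (meanMax N k - meanMax N (k - 1)) / k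
      ≤ 1 / t * (1 / (k * (k + 1))) + 2 * absMean * Φ ^ (p - 1) := by
    intro k hk
    rw [Finset.mem_Ico] at hk
    obtain ⟨j, rfl⟩ : ∃ j, k = j + 1 := ⟨k - 1, by omega⟩
    have h := meanMax_succ_sub_le (k := j) (N := N) (by omega) ht
    rw [← hΦ] at h
    have h1 : Φ ^ j ≤ Φ ^ (p - 1) := pow_le_pow_of_le_one hΦ0 hΦ1 (by omega)
    have hj : (1 : ℝ) ≤ j + 1 := by linarith [j.cast_nonneg (α := ℝ)]
    have h2 : 2 * absMean * Φ ^ j / (j + 1) ≤ 2 * absMean * Φ ^ (p - 1) :=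
      (div_le_self (by positivity) hj).trans (by gcongr)
    simp only [Nat.add_sub_cancel]
    push_cast
    calc _ ≤ (1 / t * (1 / (j + 2)) + 2 * absMean * Φ ^ j) / ((j : ℝ) + 1) := by gcongr
      _ = 1 / t * (1 / ((j + 1) * (j + 1 + 1))) + 2 * absMean * Φ ^ j / (j + 1) := by
          field_simp; ring
      _ ≤ _ := by gcongr
  refine (Finset.sum_le_sum hterm).trans ?_
  -- Abel summation with the constant sequence 1 is the telescoping of 1/(k(k+1)).
  rw [Finset.sum_add_distrib, ← Finset.mul_sum, sum_Ico_div_mul_succ (fun _ => 1) hp hpN,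
    Finset.sum_const, Nat.card_Ico, nsmul_eq_mul]
  have hN : 0 ≤ 1 / (N : ℝ) := by positivity
  have h3 : 1 / t * (1 / (p : ℝ) - 1 / N + ∑ k ∈ Finset.Ico p N, ((1 : ℝ) - 1) / k)
      ≤ 1 / (t * p) := by
    simp only [sub_self, zero_div, Finset.sum_const_zero, add_zero]
    rw [← one_div_mul_one_div]
    gcongr
    linarith
  have h4 : ((N - p : ℕ) : ℝ) ≤ N := by exact_mod_cast Nat.sub_le N p
  gcongr

/-- The density of the standard normal law at `0`, divided by `e`. -/
noncomputable def tailConst : ℝ := (√(2 * Real.pi))⁻¹ * Real.exp (-1)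

theorem tailConst_pos : 0 < tailConst := by unfold tailConst; positivity

theorem sum_increments_le_of_large {N p : ℕ} {ℓ L : ℝ} (hN : 4 ≤ N + 1) (hpN : p ≤ N)
    (hℓ : ℓ = Real.log ((N + 1 : ℕ) : ℝ)) (hL : 128 ≤ L)
    (hA : absMean ≤ √ℓ / 8)
    (hexp : ℓ * (1 + 2 * ℓ) ≤ tailConst * Real.exp (3 / 4 * ℓ))
    (hp : ((N + 1 : ℕ) : ℝ) * L / (4 * ℓ) ≤ p) :
    2 ≤ p ∧ ∑ k ∈ Finset.Ico p N, (meanMax N k - meanMax N (k - 1)) / k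
      ≤ meanMax N (N - 1) / N := by
  set n : ℝ := ((N + 1 : ℕ) : ℝ) with hn
  have hn4 : (4 : ℝ) ≤ n := by rw [hn]; exact_mod_cast hN
  have hℓ0 : 0 < ℓ := hℓ ▸ Real.log_pos (by linarith)
  have hnexp : n = Real.exp ℓ := by rw [hℓ, Real.exp_log (by linarith)]
  have hℓn : ℓ ≤ n := by rw [hnexp]; linarith [Real.add_one_le_exp ℓ]
  -- Here 32 = 128/4, from L ≥ 128.
  have hp32 : 32 * (n / ℓ) ≤ p := by
    refine le_trans ?_ hp
    rw [← mul_div_assoc, div_le_div_iff₀ hℓ0 (by positivity)]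
    have : 0 ≤ n * ℓ * (L - 128) := by have := sub_nonneg.2 hL; positivity
    nlinarith
  have hnl : 1 ≤ n / ℓ := (one_le_div hℓ0).2 hℓn
  have hp2 : (2 : ℝ) ≤ p := by linarith
  have hp2' : 2 ≤ p := by exact_mod_cast hp2
  refine ⟨hp2', ?_⟩
  -- Then exp(-t²) = n^(-1/4), so with p of order at least n/ℓ the power Φ^(p-1) is negligible. The
  -- budget is t/(8n) for the main term and t/(4n) for the error, against the lower bound t/(2n).
  set t : ℝ := √ℓ / 2 with ht
  have ht0 : 0 < t := by positivity
  have htsq : t ^ 2 = ℓ / 4 := by rw [ht, div_pow, Real.sq_sqrt hℓ0.le]; norm_num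
  have hAt : absMean ≤ t / 4 := by rw [ht]; linarith
  set Φ := (gaussianReal 0 1).real (Set.Iio t) with hΦ
  have hΦ0 : 0 ≤ Φ := measureReal_nonneg
  have hΦ1 : Φ ≤ 1 := measureReal_le_one
  have hε : Φ ^ (p - 1) ≤ 1 / (2 * n ^ 2) := by
    have hq : (√(2 * Real.pi))⁻¹ * Real.exp (-(t ^ 2 + 1)) = tailConst * Real.exp (-(ℓ / 4)) := by
      rw [htsq, tailConst, mul_assoc, ← Real.exp_add]
      congr 2; ring
    have h1 := gaussianReal_real_Iio_le t
    rw [hq, ← hΦ] at h1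
    have hcast : ((p - 1 : ℕ) : ℝ) = p - 1 := by push_cast [show 1 ≤ p by omega]; ring
    have h2 : 1 + 2 * ℓ ≤ ((p - 1 : ℕ) : ℝ) * (tailConst * Real.exp (-(ℓ / 4))) := by
      have h3 : Real.exp ℓ / ℓ ≤ ((p - 1 : ℕ) : ℝ) := by
        rw [hcast, ← hnexp]; linarith
      have hc := tailConst_pos
      calc 1 + 2 * ℓ ≤ tailConst * Real.exp (3 / 4 * ℓ) / ℓ := by
            rw [le_div_iff₀ hℓ0]; linarith
        _ = Real.exp ℓ / ℓ * (tailConst * Real.exp (-(ℓ / 4))) := by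
            rw [show (3 / 4 * ℓ : ℝ) = ℓ + -(ℓ / 4) by ring, Real.exp_add]; ring
        _ ≤ _ := by gcongr
    calc Φ ^ (p - 1) ≤ Real.exp (-(tailConst * Real.exp (-(ℓ / 4)))) ^ (p - 1) :=
          pow_le_pow_left₀ hΦ0 h1 _
      _ = Real.exp (-(((p - 1 : ℕ) : ℝ) * (tailConst * Real.exp (-(ℓ / 4))))) := by
          rw [← Real.exp_nat_mul]; congr 1; ring
      _ ≤ Real.exp (-(1 + 2 * ℓ)) := Real.exp_le_exp.2 (by linarith)
      _ ≤ 1 / (2 * n ^ 2) := by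
          rw [Real.exp_neg, ← one_div, Real.exp_add, hnexp, ← Real.exp_nat_mul]
          push_cast
          have := Real.add_one_le_exp (1 : ℝ)
          gcongr
          linarith
  have hε' : Φ ^ (p - 1) ≤ 1 / 4 := by
    refine hε.trans (one_div_le_one_div_of_le (by norm_num) ?_)
    nlinarith
  have hNn : (N : ℝ) ≤ n := by rw [hn]; push_cast; linarith
  have hN0 : (0 : ℝ) < N := by
    have : 0 < N := by omega
    exact_mod_cast this
  have hlow : t / 2 ≤ meanMax N (N - 1) := by
    have h1 := le_meanMax (N := N) (k := N - 1) (by omega) t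
    have h2 : Φ ^ (N - 1 + 1) ≤ Φ ^ (p - 1) := pow_le_pow_of_le_one hΦ0 hΦ1 (by omega)
    rw [← hΦ] at h1
    have : t * (1 / 4) ≥ t * Φ ^ (N - 1 + 1) := by gcongr; linarith
    nlinarith
  have hlow' : t / 2 / n ≤ meanMax N (N - 1) / N := by
    have : 0 ≤ meanMax N (N - 1) := by linarith
    gcongr
  refine (sum_increments_le (by omega) hpN ht0).trans (le_trans ?_ hlow')
  rw [← hΦ]
  have h1 : 1 / (t * p) ≤ t / 8 / n := by
    rw [div_le_div_iff₀ (by positivity) (by linarith)]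
    have : n * 8 ≤ t ^ 2 * p := by
      rw [htsq]
      rw [← mul_div_assoc, div_le_iff₀ hℓ0] at hp32
      linarith
    linarith
  have h2 : N * (2 * absMean * Φ ^ (p - 1)) ≤ t / 4 / n := by
    calc N * (2 * absMean * Φ ^ (p - 1)) ≤ n * (2 * (t / 4) * (1 / (2 * n ^ 2))) := by
          have := absMean_nonneg
          gcongr
      _ = t / 4 / n := by field_simp
  have h3 : t / 2 / n = t / 8 / n + t / 4 / n + t / 8 / n := by ring
  have h4 : 0 ≤ t / 8 / n := by positivity
  linarith

theorem eventually_large : ∀ᶠ n : ℕ in atTop, 4 ≤ n ∧ 128 ≤ Real.log (Real.log n) ∧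
    absMean ≤ √(Real.log n) / 8 ∧
    Real.log n * (1 + 2 * Real.log n) ≤ tailConst * Real.exp (3 / 4 * Real.log n) := by
  have hlog : Tendsto (fun n : ℕ => Real.log n) atTop atTop :=
    Real.tendsto_log_atTop.comp tendsto_natCast_atTop_atTop
  have h1 := (Real.tendsto_log_atTop.comp hlog).eventually_ge_atTop 128
  have h2 := (Real.tendsto_sqrt_atTop.comp hlog).eventually_ge_atTop (8 * absMean)
  -- The 3 absorbs ℓ(1 + 2ℓ) ≤ 3ℓ², valid for ℓ = log n ≥ 1.
  have hc : 0 < tailConst / 3 := div_pos tailConst_pos (by norm_num)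
  have h3 := hlog.eventually ((isLittleO_pow_exp_pos_mul_atTop 2
    (show (0 : ℝ) < 3 / 4 by norm_num)).bound hc)
  have h4 := hlog.eventually_ge_atTop 1
  filter_upwards [h1, h2, h3, h4, eventually_ge_atTop 4] with n h1 h2 h3 h4 h5
  refine ⟨h5, h1, ?_, ?_⟩
  · simp only [Function.comp_apply] at h2; linarith
  · rw [Real.norm_of_nonneg (by positivity), Real.norm_of_nonneg (by positivity)] at h3
    nlinarith

/-- For n ≥ 4, n - 2 ≥ n/2, and the denominator is at most 2 log n because 2π > 1. -/
theorem le_threshold_bound {n : ℕ} (hn : 4 ≤ n) (hL : 0 ≤ Real.log (Real.log n)) :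
    (n : ℝ) * Real.log (Real.log n) / (4 * Real.log n)
      ≤ ((n : ℝ) - 2) * Real.log (Real.log n) / Real.log (((n : ℝ) - 1) ^ 2 / (2 * Real.pi)) := by
  have hn' : (4 : ℝ) ≤ n := by exact_mod_cast hn
  have hpi : 2 * Real.pi < 9 := by linarith [Real.pi_lt_four]
  have hpi3 := Real.pi_gt_three
  have hpos : 0 < Real.log (((n : ℝ) - 1) ^ 2 / (2 * Real.pi)) := by
    refine Real.log_pos ((one_lt_div (by positivity)).2 ?_)
    nlinarith
  have hle : Real.log (((n : ℝ) - 1) ^ 2 / (2 * Real.pi)) ≤ 2 * Real.log n := by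
    rw [← Real.log_rpow (by linarith)]
    refine Real.log_le_log ?_ ?_
    · have : 0 < (n : ℝ) - 1 := by linarith
      positivity
    · rw [div_le_iff₀ (by positivity), Real.rpow_two]
      nlinarith
  have hlog : 0 < Real.log n := Real.log_pos (by linarith)
  calc (n : ℝ) * Real.log (Real.log n) / (4 * Real.log n)
      = ((n : ℝ) / 2) * Real.log (Real.log n) / (2 * Real.log n) := by field_simp; ring
    _ ≤ _ := div_le_div₀ (mul_nonneg (by linarith) hL)
        (mul_le_mul_of_nonneg_right (by linarith) hL) hpos hle

theorem measurable_hiredQuality {N : ℕ} (c : ℕ) :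
    Measurable (hiredQuality c : (Fin (N + 1) → ℝ) → ℝ) := by
  classical
  unfold hiredQuality
  refine Finset.measurable_sum _ fun k _ => ?_
  exact Measurable.ite (measurableSet_hired c k) (measurable_pi_apply k) measurable_const

theorem expectedQuality_eq {Ω : Type*} [MeasurableSpace Ω] {P : Measure Ω} [IsProbabilityMeasure P]
    {N : ℕ} {X : Fin (N + 1) → Ω → ℝ} (hX : iIndepFun X P)
    (hlaw : ∀ k, HasLaw (X k) (gaussianReal 0 1) P) (c : ℕ) :
    expectedQuality P X c = ∫ x, hiredQuality c x ∂(iidNormal N) := by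
  have hm := (iIndepFun_iff_map_fun_eq_pi_map fun k => (hlaw k).aemeasurable).1 hX
  simp only [(hlaw _).map_eq] at hm
  change _ = iidNormal N at hm
  rw [← hm, integral_map (aemeasurable_pi_lambda _ fun k => (hlaw k).aemeasurable)
    (measurable_hiredQuality c).aestronglyMeasurable]
  rfl

/-- With S the sum over p ≤ k < N, V(p+1) - V(p) = pS - (e_{p-1}/p + (p-1)S) = S - e_{p-1}/p, whose
sign is read off from Abel summation. The value formula at threshold p needs p - 1 ≥ 1. -/
theorem expectedQuality_succ_le {Ω : Type*} [MeasurableSpace Ω] {P : Measure Ω}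
    [IsProbabilityMeasure P] {N : ℕ} {X : Fin (N + 1) → Ω → ℝ} (hX : iIndepFun X P)
    (hlaw : ∀ k, HasLaw (X k) (gaussianReal 0 1) P) {p : ℕ} (hp : 2 ≤ p) (hpN : p ≤ N)
    (h : ∑ k ∈ Finset.Ico p N, (meanMax N k - meanMax N (k - 1)) / k ≤ meanMax N (N - 1) / N) :
    expectedQuality P X (p + 1) ≤ expectedQuality P X p := by
  obtain ⟨d, rfl⟩ : ∃ d, p = d + 1 := ⟨p - 1, by omega⟩
  have hsum := sum_Ico_div_mul_succ (meanMax N) (p := d + 1) (N := N) (by omega) hpN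
  rw [expectedQuality_eq hX hlaw, expectedQuality_eq hX hlaw, integral_hiredQuality (by omega) hpN,
    integral_hiredQuality (by omega) (by omega), Finset.sum_eq_sum_Ico_succ_bot (a := d) (by omega)]
  set S := ∑ k ∈ Finset.Ico (d + 1) N, meanMax N k / (k * (k + 1))
  have hS : S ≤ meanMax N d / (d + 1) := by
    have hd : d + 1 - 1 = d := rfl
    rw [hd] at hsum
    push_cast at hsum
    linarith
  have hd : (d : ℝ) ≠ 0 := by rw [Nat.cast_ne_zero]; omega
  have : (d : ℝ) * (meanMax N d / (d * (d + 1))) = meanMax N d / (d + 1) := by field_simp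
  push_cast
  linarith

end Secretary

theorem mainTheorem11 :
    ∃ N : ℕ, ∀ n : ℕ, N ≤ n →
      ∀ {Ω : Type*} [MeasurableSpace Ω] (P : Measure Ω) [IsProbabilityMeasure P]
        (X : Fin n → Ω → ℝ),
        iIndepFun X P → (∀ k, HasLaw (X k) (gaussianReal 0 1) P) →
          (Secretary.optimalThreshold P X : ℝ) ≤
            ((n : ℝ) - 2) * Real.log (Real.log n) /
              Real.log (((n : ℝ) - 1) ^ 2 / (2 * Real.pi)) + 1 := by
  obtain ⟨M, hM⟩ := Filter.eventually_atTop.1 Secretary.eventually_large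
  refine ⟨M, fun n hn Ω _ P _ X hX hlaw => ?_⟩
  obtain ⟨h4, hL, hA, hexp⟩ := hM n hn
  have hbound := Secretary.le_threshold_bound h4 (by linarith)
  obtain ⟨N, rfl⟩ : ∃ N, n = N + 1 := ⟨n - 1, by omega⟩
  obtain ⟨hmem, hmax⟩ := Secretary.optimalThreshold_mem P (by omega) X
  by_contra hlt
  push Not at hlt
  obtain ⟨p, hp⟩ : ∃ p, Secretary.optimalThreshold P X = p + 1 :=
    ⟨Secretary.optimalThreshold P X - 1, by have := hmem.1; omega⟩
  have hpN : p ≤ N := by have := hmem.2; omega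
  rw [hp] at hlt hmax
  push_cast at hlt hbound
  obtain ⟨hp2, hsum⟩ := Secretary.sum_increments_le_of_large h4 hpN rfl hL hA hexp
    (by push_cast; linarith)
  have hle := Secretary.expectedQuality_succ_le hX hlaw hp2 hpN hsum
  -- Since V(p) ≥ V(p+1) and p + 1 is a maximizer, p is a smaller one.
  have hmin : Secretary.optimalThreshold P X ≤ p :=
    Nat.sInf_le ⟨⟨by omega, by omega⟩, fun d hd => (hmax d hd).trans hle⟩
  omega
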